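/- For an open set $D\subseteq\mathbb C^n$ let $A^2(D)$ be the Hilbert space of holomorphic functions on $D$ that are square-integrable with respect to Lebesgue measure, and let $K_D(z,w)=\sum_k \varphi_k(z)\overline{\varphi_k(w)}$, where $(\varphi_k)$ is an orthonormal basis of $A^2(D)$, be the Bergman kernel of $D$. By a domain we mean a nonempty connected open set. **Proposition.** Let $D_1,D_2\subseteq\mathbb C^n$ be domains, and assume that their Bergman kernels satisfy $$K_{D_j}(z,z)=C_j\bigl(1+\|z\|^2\bigr)^m\quad\text{for } z\in D_j,\qquad j=1,2,$$ for some constants $C_1,C_2>0$ and some integer $m\ge 1$. Let $U_1\subseteq D_1$ and $U_2\subseteq D_2$ be subdomains, and let $F:U_1\to U_2$ be a biholomorphic map which preserves the Bergman kernel forms of $D_1$ and $D_2$, in the sense that $$K_{D_1}(z,z)=K_{D_2}\bigl(F(z),F(z)\bigr)\,|\det F'(z)|^2\quad\text{for all } z\in U_1,$$ where $F'(z)$ is the complex Jacobian matrix of $F$ at $z$. Then $F$ is a unitary map, that is, there is a unitary matrix $B\in U(n)$ with $F(z)=Bz$ for all $z\in U_1$; moreover $C_1=C_2$. -/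

import Mathlib

open MeasureTheory
open scoped ComplexConjugate

/-- Complex Euclidean space `ℂⁿ`; `‖z‖` is the Euclidean norm and `volume` is the Lebesgue measure
of the underlying real Euclidean space of dimension `2n`. -/
abbrev CSpace (n : ℕ) : Type := EuclideanSpace ℂ (Fin n)

/-- A domain in `ℂⁿ`: a nonempty connected open set. -/
def IsDomainIn {n : ℕ} (D : Set (CSpace n)) : Prop :=
  IsOpen D ∧ IsConnected D

/-- `f` is holomorphic on `D`: near every point of `D` it is the sum of a convergent power series
in the complex coordinates. -/
def HolomorphicOn {n : ℕ} {V : Type*} [NormedAddCommGroup V] [NormedSpace ℂ V]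
    (f : CSpace n → V) (D : Set (CSpace n)) : Prop :=
  AnalyticOnNhd ℂ f D

/-- `F` restricts to a biholomorphic map from `U` onto `V`: it is holomorphic on `U`, maps `U`
bijectively onto `V`, and the inverse map is holomorphic on `V`. -/
def IsBiholomorphicMap {n : ℕ} (F : CSpace n → CSpace n) (U V : Set (CSpace n)) : Prop :=
  HolomorphicOn F U ∧ Set.MapsTo F U V ∧
    ∃ G : CSpace n → CSpace n, HolomorphicOn G V ∧ Set.MapsTo G V U ∧ Set.InvOn G F U V

/-- The Bergman space `A²(D)`: the square-integrable holomorphic functions on `D`, as a subspace of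
`L²(D)` with its inner product `⟪f, g⟫ = ∫_D conj f * g` (conjugate-linear in the first slot). -/
noncomputable def bergmanSpace {n : ℕ} (D : Set (CSpace n)) :
    Submodule ℂ (Lp ℂ 2 ((volume : Measure (CSpace n)).restrict D)) where
  carrier := {f | ∃ g : CSpace n → ℂ, HolomorphicOn g D ∧ f =ᵐ[volume.restrict D] g}
  zero_mem' := ⟨fun _ => 0, fun _ _ => analyticAt_const, Lp.coeFn_zero _ _ _⟩
  add_mem' := by
    rintro f₁ f₂ ⟨g₁, hg₁, h₁⟩ ⟨g₂, hg₂, h₂⟩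
    exact ⟨g₁ + g₂, AnalyticOnNhd.add hg₁ hg₂, (Lp.coeFn_add f₁ f₂).trans (h₁.add h₂)⟩
  smul_mem' := by
    rintro c f ⟨g, hg, h⟩
    exact ⟨c • g, AnalyticOnNhd.const_smul hg, (Lp.coeFn_smul c f).trans (h.const_smul c)⟩

/-- The holomorphic function on `D` represented by an element of `A²(D)`. For open `D` its values on
`D` are uniquely determined; its values outside `D` have no meaning. -/
noncomputable def bergmanRep {n : ℕ} {D : Set (CSpace n)} (f : bergmanSpace D) : CSpace n → ℂ :=
  Classical.choose f.2

theorem bergmanRep_spec {n : ℕ} {D : Set (CSpace n)} (f : bergmanSpace D) :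
    HolomorphicOn (bergmanRep f) D ∧
      (f : Lp ℂ 2 ((volume : Measure (CSpace n)).restrict D)) =ᵐ[volume.restrict D] bergmanRep f :=
  Classical.choose_spec f.2

theorem exists_bergmanBasis {n : ℕ} (D : Set (CSpace n)) :
    ∃ S : Set (bergmanSpace D), Orthonormal ℂ (Subtype.val : S → bergmanSpace D) ∧
      ∀ T : Set (bergmanSpace D), S ⊆ T → Orthonormal ℂ (Subtype.val : T → bergmanSpace D) →
        T = S := by
  obtain ⟨S, -, hS, hmax⟩ := exists_maximal_orthonormal
    (𝕜 := ℂ) (E := bergmanSpace D) (s := ∅) (orthonormal_empty ℂ (bergmanSpace D))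
  exact ⟨S, hS, hmax⟩

/-- An orthonormal basis of the Hilbert space `A²(D)`: a maximal orthonormal set. -/
noncomputable def bergmanBasis {n : ℕ} (D : Set (CSpace n)) : Set (bergmanSpace D) :=
  Classical.choose (exists_bergmanBasis D)

/-- The Bergman kernel `K_D(z, w) = ∑ₖ φₖ(z) * conj (φₖ(w))`, where `(φₖ)` is an orthonormal basis of
`A²(D)`. For open `D` and `z, w ∈ D` the series converges absolutely and its sum does not depend on
the orthonormal basis. -/
noncomputable def bergmanKernel {n : ℕ} (D : Set (CSpace n)) (z w : CSpace n) : ℂ :=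
  ∑' φ : bergmanBasis D, bergmanRep φ.1 z * conj (bergmanRep φ.1 w)

/-! Only the transformation rule `C₁(1+‖z‖²)^m = C₂(1+‖F‖²)^m |J|²`, with `J = det F'`, is used
about the kernels. Polarizing and freezing the second variable at `p` exhibits `J` as a constant
times `l^m`, where `l` is holomorphic. Taking `m`-th roots on the diagonal and polarizing again, the
map `(1, z) ↦ (l, l F)` preserves inner products (`exists_root_of_jacobian`). Such a map preserves
linear relations, so `l` and `g = l F` are affine and `F = g / l` is projective
(`affine_of_inner_eq`). Its Jacobian is a determinant polynomial of degree at most `n` along each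
line, divided by `l^(2n)`; equating it with a multiple of `l^m`, `m ≥ 1`, forces `l` to be constant
(`linear_denominator_eq_zero`). Then `F` is affine, and the inner product identity makes it a linear
isometry near `p`. The identity theorem extends this to `U₁`. -/

/-! ### Polarization: from the diagonal to pairs of points. -/

section Polarization

open Complex Set Filter Topology

variable {E : Type*} [NormedAddCommGroup E] [NormedSpace ℂ E] {B : Set E}

/-- `Φ z w` is holomorphic in `z` and antiholomorphic in `w` along the complex lines
`t ↦ (u + t v, u + conj t v)`. -/
def SesquiHolomorphicOn (Φ : E → E → ℂ) (B : Set E) : Prop :=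
  ∀ (u v : E) (t : ℂ), u + t • v ∈ B → u + conj t • v ∈ B →
    DifferentiableAt ℂ (fun s : ℂ => Φ (u + s • v) (u + conj s • v)) t

namespace SesquiHolomorphicOn

variable {Φ Ψ : E → E → ℂ}

theorem const (c : ℂ) : SesquiHolomorphicOn (fun _ _ : E => c) B :=
  fun _ _ _ _ _ => differentiableAt_const c

theorem add (hΦ : SesquiHolomorphicOn Φ B) (hΨ : SesquiHolomorphicOn Ψ B) :
    SesquiHolomorphicOn (fun z w => Φ z w + Ψ z w) B :=
  fun u v t h₁ h₂ => (hΦ u v t h₁ h₂).add (hΨ u v t h₁ h₂)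

theorem sub (hΦ : SesquiHolomorphicOn Φ B) (hΨ : SesquiHolomorphicOn Ψ B) :
    SesquiHolomorphicOn (fun z w => Φ z w - Ψ z w) B :=
  fun u v t h₁ h₂ => (hΦ u v t h₁ h₂).sub (hΨ u v t h₁ h₂)

theorem mul (hΦ : SesquiHolomorphicOn Φ B) (hΨ : SesquiHolomorphicOn Ψ B) :
    SesquiHolomorphicOn (fun z w => Φ z w * Ψ z w) B :=
  fun u v t h₁ h₂ => (hΦ u v t h₁ h₂).mul (hΨ u v t h₁ h₂)

theorem pow (hΦ : SesquiHolomorphicOn Φ B) (m : ℕ) :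
    SesquiHolomorphicOn (fun z w => Φ z w ^ m) B :=
  fun u v t h₁ h₂ => (hΦ u v t h₁ h₂).pow m

theorem sum {ι : Type*} {s : Finset ι} {Φ : ι → E → E → ℂ}
    (hΦ : ∀ i ∈ s, SesquiHolomorphicOn (Φ i) B) :
    SesquiHolomorphicOn (fun z w => ∑ i ∈ s, Φ i z w) B :=
  fun u v t h₁ h₂ => DifferentiableAt.fun_sum fun i hi => hΦ i hi u v t h₁ h₂

theorem left {f : E → ℂ} (hf : ∀ z ∈ B, DifferentiableAt ℂ f z) :
    SesquiHolomorphicOn (fun z _ => f z) B :=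
  fun u v t h₁ _ => (hf _ h₁).comp t (f := fun s : ℂ => u + s • v) (by fun_prop)

theorem right {f : E → ℂ} (hf : ∀ z ∈ B, DifferentiableAt ℂ f z) :
    SesquiHolomorphicOn (fun _ w => conj (f w)) B := fun u v t _ h₂ => by
  have h : DifferentiableAt ℂ (fun s : ℂ => f (u + s • v)) (conj t) :=
    (hf _ h₂).comp _ (f := fun s : ℂ => u + s • v) (by fun_prop)
  simpa [Function.comp_def] using h.star_star

theorem inner {n : ℕ} {f : E → CSpace n} (hf : ∀ z ∈ B, DifferentiableAt ℂ f z) :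
    SesquiHolomorphicOn (fun z w => inner ℂ (f w) (f z)) B := by
  have h (i : Fin n) : ∀ z ∈ B, DifferentiableAt ℂ (fun x => f x i) z :=
    fun z hz => differentiableAt_euclidean.1 (hf z hz) i
  have := sum (B := B) (s := Finset.univ) fun (i : Fin n) _ => (left (h i)).mul (right (h i))
  simpa [PiLp.inner_apply] using this

/-- A function holomorphic in `z` and antiholomorphic in `w` which vanishes on the diagonal of a
convex open set vanishes identically. -/
theorem eq_zero (hΦ : SesquiHolomorphicOn Φ B) (hB : IsOpen B) (hc : Convex ℝ B)
    (h0 : ∀ z ∈ B, Φ z z = 0) {z w : E} (hz : z ∈ B) (hw : w ∈ B) : Φ z w = 0 := by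
  -- With these `u, v`, the path `t ↦ (u + t v, u + conj t v)` lies on the diagonal for real `t` and
  -- passes through `(z, w)` at `t = I`. The one-variable identity theorem then applies.
  set u : E := (1 / 2 : ℂ) • (z + w) with hu
  set v : E := (1 / (2 * I) : ℂ) • (z - w) with hv
  set S : Set ℂ := {t | u + t • v ∈ B} ∩ {t | u + conj t • v ∈ B}
  have hSo : IsOpen S :=
    (hB.preimage (f := fun t : ℂ => u + t • v) (by fun_prop)).inter
      (hB.preimage (f := fun t : ℂ => u + conj t • v)
        (continuous_const.add (continuous_conj.smul continuous_const)))
  have hSc : Convex ℝ S := by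
    rintro x ⟨hx, hx'⟩ y ⟨hy, hy'⟩ a b ha hb hab
    have hua : (a : ℂ) • u + (b : ℂ) • u = u := by
      rw [← add_smul, ← ofReal_add, hab, ofReal_one, one_smul]
    constructor
    · have := hc hx hy ha hb hab
      simp only [mem_ofPred_eq]
      convert this using 1
      simp only [← Complex.coe_smul, smul_eq_mul]
      conv_lhs => rw [← hua]
      module
    · have := hc hx' hy' ha hb hab
      simp only [mem_ofPred_eq]
      convert this using 1
      simp only [← Complex.coe_smul, smul_eq_mul, map_add, map_mul, conj_ofReal]
      conv_lhs => rw [← hua]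
      module
  have hI : u + I • v = z := by
    rw [hu, hv, smul_smul]
    have : I * (1 / (2 * I)) = 1 / 2 := by field_simp
    rw [this]; module
  have hI' : u + conj I • v = w := by
    rw [hu, hv, smul_smul, conj_I]
    have : -I * (1 / (2 * I)) = -(1 / 2) := by field_simp
    rw [this]; module
  have huB : u ∈ B := by
    have := hc hz hw (a := 1 / 2) (b := 1 / 2) (by norm_num) (by norm_num) (by norm_num)
    convert this using 1
    simp only [hu, ← Complex.coe_smul]
    push_cast
    module
  have hS0 : (0 : ℂ) ∈ S := by simp [S, huB]
  have hSI : I ∈ S := ⟨by simpa only [mem_ofPred_eq, hI], by simpa only [mem_ofPred_eq, hI']⟩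
  have han : AnalyticOnNhd ℂ (fun s : ℂ => Φ (u + s • v) (u + conj s • v)) S :=
    DifferentiableOn.analyticOnNhd
      (fun t ht => (hΦ u v t ht.1 ht.2).differentiableWithinAt) hSo
  have hfreq : ∃ᶠ t : ℂ in 𝓝[≠] 0, Φ (u + t • v) (u + conj t • v) = 0 := by
    have h1 : Tendsto (fun x : ℝ => (x : ℂ)) (𝓝[≠] 0) (𝓝[≠] 0) := by
      refine tendsto_nhdsWithin_iff.2 ⟨?_, ?_⟩
      · exact (continuous_ofReal.tendsto' 0 0 (by simp)).mono_left nhdsWithin_le_nhds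
      · filter_upwards [self_mem_nhdsWithin] with x hx
        simpa using hx
    have h2 : ∀ᶠ x : ℝ in 𝓝[≠] 0, Φ (u + (x : ℂ) • v) (u + conj (x : ℂ) • v) = 0 := by
      filter_upwards [h1.eventually (mem_nhdsWithin_of_mem_nhds (hSo.mem_nhds hS0))] with x hx
      rw [conj_ofReal]
      exact h0 _ hx.1
    exact h1.frequently h2.frequently
  have := han.eqOn_zero_of_preconnected_of_frequently_eq_zero hSc.isPreconnected hS0 hfreq hSI
  simpa only [hI, hI', Pi.zero_apply] using this

end SesquiHolomorphicOn

end Polarization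

/-! ### Inner product preserving maps and projective maps. -/

section Rigidity

open Complex Set Filter Topology

/-- The squared norm of a linear combination depends only on the Gram matrix. -/
theorem smul_combination_eq_zero_of_inner_eq {V V' : Type*} [NormedAddCommGroup V]
    [InnerProductSpace ℂ V] [NormedAddCommGroup V'] [InnerProductSpace ℂ V'] {ι : Type*}
    {v : ι → V} {W : ι → V'} (h : ∀ i j, inner ℂ (W i) (W j) = inner ℂ (v i) (v j))
    {a b c : ℂ} {i j k : ι} (h0 : a • v i + b • v j + c • v k = 0) :
    a • W i + b • W j + c • W k = 0 := by
  have h1 : inner ℂ (a • v i + b • v j + c • v k) (a • v i + b • v j + c • v k) = (0 : ℂ) := by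
    rw [h0, inner_zero_left]
  rw [← inner_self_eq_zero (𝕜 := ℂ), ← h1]
  simp only [inner_add_left, inner_add_right, inner_smul_left, inner_smul_right, h]

variable {E : Type*} [NormedAddCommGroup E] [InnerProductSpace ℂ E]

/-- A map which preserves the inner products of the vectors `(1, z)` is affine. -/
theorem affine_of_inner_eq {B : Set E} (hc : Convex ℝ B) {l : E → ℂ} {g : E → E}
    {p : E} (hp : p ∈ B) (hl : DifferentiableAt ℂ l p) (hg : DifferentiableAt ℂ g p)
    (h : ∀ z ∈ B, ∀ w ∈ B,
      1 + inner ℂ w z = l z * conj (l w) + inner ℂ (g w) (g z)) {z : E} (hz : z ∈ B) :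
    l z = l p + fderiv ℂ l p (z - p) ∧ g z = g p + fderiv ℂ g p (z - p) := by
  have key : ∀ᶠ t : ℝ in 𝓝[>] 0, l (p + t • (z - p)) = l p + (t : ℂ) * (l z - l p) ∧
      g (p + t • (z - p)) = g p + (t : ℂ) • (g z - g p) := by
    filter_upwards [Ioo_mem_nhdsGT (zero_lt_one (α := ℝ))] with t ht
    have hw : p + t • (z - p) ∈ B := hc.add_smul_sub_mem hp hz ⟨ht.1.le, ht.2.le⟩
    let v : B → WithLp 2 (ℂ × E) := fun x => WithLp.toLp 2 (1, x.1)
    let W : B → WithLp 2 (ℂ × E) := fun x => WithLp.toLp 2 (l x, g x)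
    have hvW : ∀ x y, inner ℂ (W x) (W y) = inner ℂ (v x) (v y) := fun x y => by
      have := h y y.2 x x.2
      simp only [v, W, WithLp.prod_inner_apply, RCLike.inner_apply, map_one, mul_one]
      exact this.symm
    -- The leading coordinate `1` turns this affine relation between points into a linear one
    -- between vectors.
    have h3 := smul_combination_eq_zero_of_inner_eq hvW (a := 1 - (t : ℂ)) (b := t) (c := -1)
      (i := ⟨p, hp⟩) (j := ⟨z, hz⟩) (k := ⟨_, hw⟩) (by
        apply WithLp.ofLp_injective 2
        ext
        · simp [v]
        · simp only [v, WithLp.ofLp_add, WithLp.ofLp_smul, Prod.snd_add, Prod.smul_snd,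
            WithLp.ofLp_zero, Prod.snd_zero, ← Complex.coe_smul]
          module)
    have h4 := congrArg (fun x => (WithLp.ofLp x).1) h3
    have h5 := congrArg (fun x => (WithLp.ofLp x).2) h3
    simp only [W, WithLp.ofLp_add, WithLp.ofLp_smul, Prod.snd_add, Prod.smul_snd, Prod.fst_add,
      Prod.smul_fst, WithLp.ofLp_zero, Prod.snd_zero, Prod.fst_zero, smul_eq_mul] at h4 h5
    constructor
    · linear_combination -h4
    · rw [← sub_eq_zero, ← neg_eq_zero, ← h5]
      module
  have hline : HasDerivAt (fun t : ℝ => p + t • (z - p)) (z - p) 0 := by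
    simpa using ((hasDerivAt_id (0 : ℝ)).smul_const (z - p)).const_add p
  have hp0 : p = p + (0 : ℝ) • (z - p) := by simp
  have hcast : HasDerivAt (fun t : ℝ => (t : ℂ)) 1 0 := ofRealCLM.hasDerivAt
  constructor
  · have h1 : HasDerivAt (fun t : ℝ => l (p + t • (z - p))) (fderiv ℂ l p (z - p)) 0 := by
      have : HasFDerivAt l ((fderiv ℂ l p).restrictScalars ℝ) (p + (0 : ℝ) • (z - p)) := by
        rw [← hp0]; exact hl.hasFDerivAt.restrictScalars ℝ
      exact this.comp_hasDerivAt (0 : ℝ) hline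
    have h2 : HasDerivAt (fun t : ℝ => l p + (t : ℂ) * (l z - l p)) (l z - l p) 0 := by
      simpa using (hcast.mul_const (l z - l p)).const_add (l p)
    -- The affine formula is available only for `t` in `(0, 1)`, so one-sided derivatives at `0` are
    -- compared.
    have := (uniqueDiffWithinAt_Ioi (0 : ℝ)).eq_deriv _ (h1.hasDerivWithinAt)
      (h2.hasDerivWithinAt.congr_of_eventuallyEq (key.mono fun _ h => h.1) (by simp))
    rw [this]; ring
  · have h1 : HasDerivAt (fun t : ℝ => g (p + t • (z - p))) (fderiv ℂ g p (z - p)) 0 := by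
      have : HasFDerivAt g ((fderiv ℂ g p).restrictScalars ℝ) (p + (0 : ℝ) • (z - p)) := by
        rw [← hp0]; exact hg.hasFDerivAt.restrictScalars ℝ
      exact this.comp_hasDerivAt (0 : ℝ) hline
    have h2 : HasDerivAt (fun t : ℝ => g p + (t : ℂ) • (g z - g p)) (g z - g p) 0 := by
      simpa using (hcast.smul_const (g z - g p)).const_add (g p)
    have := (uniqueDiffWithinAt_Ioi (0 : ℝ)).eq_deriv _ (h1.hasDerivWithinAt)
      (h2.hasDerivWithinAt.congr_of_eventuallyEq (key.mono fun _ h => h.2) (by simp))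
    rw [this]; abel

/-- Degree count in `s`: the determinant has degree at most `finrank ℂ V`, while the left side has
degree `k` unless `b = 0`. -/
theorem eq_zero_of_pow_eq_det_pencil {V : Type*} [AddCommGroup V] [Module ℂ V]
    [FiniteDimensional ℂ V] {k : ℕ} (hk : Module.finrank ℂ V < k) {a b c : ℂ} {A₀ A₁ : V →ₗ[ℂ] V}
    (h : ∀ᶠ s : ℂ in 𝓝 0, (a + s * b) ^ k = c * LinearMap.det (A₀ + s • A₁)) : b = 0 := by
  open Polynomial in
  by_contra hb
  let e := Module.finBasis ℂ V
  let M₀ := LinearMap.toMatrix e e A₀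
  let M₁ := LinearMap.toMatrix e e A₁
  let P : ℂ[X] := (C b * X + C a) ^ k
  let Q : ℂ[X] := C c * Matrix.det ((X : ℂ[X]) • M₁.map C + M₀.map C)
  have hPQ : P = Q := by
    refine Polynomial.eq_of_infinite_eval_eq P Q (infinite_of_mem_nhds (0 : ℂ) ?_)
    filter_upwards [h] with s hs
    have h1 : P.eval s = (a + s * b) ^ k := by
      simp only [P, eval_pow, eval_add, eval_mul, eval_C, eval_X]; ring
    have h2 : Q.eval s = c * LinearMap.det (A₀ + s • A₁) := by
      rw [← LinearMap.det_toMatrix e]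
      simp only [Q, eval_mul, eval_C]
      rw [← Polynomial.coe_evalRingHom, RingHom.map_det]
      congr 2
      ext i j
      simp [M₀, M₁]
      ring
    rw [h1, h2, hs]
  have hP : P.natDegree = k := by
    simp only [P, natDegree_pow, natDegree_linear hb, mul_one]
  have hQ : Q.natDegree ≤ Module.finrank ℂ V := by
    refine (natDegree_C_mul_le _ _).trans ((natDegree_det_X_add_C_le _ _).trans ?_)
    simp
  rw [← hPQ, hP] at hQ
  omega

/-- A projective map `g / l` whose Jacobian determinant is a multiple of `l ^ m` with `m ≥ 1` has
constant denominator. -/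
theorem linear_denominator_eq_zero [FiniteDimensional ℂ E] {B : Set E} (hB : IsOpen B) {p : E}
    (hp : p ∈ B) {l : E → ℂ} {g F : E → E} {L : E →L[ℂ] ℂ} {G : E →L[ℂ] E}
    (hl : ∀ z ∈ B, l z = l p + L (z - p)) (hg : ∀ z ∈ B, g z = g p + G (z - p))
    (hgF : ∀ z ∈ B, g z = l z • F z) (hF : ∀ z ∈ B, DifferentiableAt ℂ F z) {m : ℕ} (hm : 1 ≤ m)
    {c : ℂ} (hdet : ∀ z ∈ B, l z ^ m = c * (fderiv ℂ F z).det) : L = 0 := by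
  have hl' : ∀ z ∈ B, HasFDerivAt l L z := fun z hz => by
    have : HasFDerivAt (fun z => l p + L (z - p)) L z := by
      have := (L.hasFDerivAt.comp z ((hasFDerivAt_id z).sub_const p)).const_add (l p)
      simpa [Function.comp_def] using this
    exact this.congr_of_eventuallyEq (by filter_upwards [hB.mem_nhds hz] with x hx using hl x hx)
  have hg' : ∀ z ∈ B, HasFDerivAt g G z := fun z hz => by
    have : HasFDerivAt (fun z => g p + G (z - p)) G z := by
      have := (G.hasFDerivAt.comp z ((hasFDerivAt_id z).sub_const p)).const_add (g p)
      simpa [Function.comp_def] using this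
    exact this.congr_of_eventuallyEq (by filter_upwards [hB.mem_nhds hz] with x hx using hg x hx)
  -- Differentiating `g = l F` gives `l G - L ⊗ g = l² F'`; taking determinants clears the
  -- denominators of the Jacobian.
  have hmul : ∀ z ∈ B, l z ^ (m + 2 * Module.finrank ℂ E) =
      c * LinearMap.det (l z • (G : E →ₗ[ℂ] E) - (L.smulRight (g z) : E →L[ℂ] E).toLinearMap) := by
    intro z hz
    have h1 : HasFDerivAt g (l z • fderiv ℂ F z + L.smulRight (F z)) z :=
      ((hl' z hz).smul (hF z hz).hasFDerivAt).congr_of_eventuallyEq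
        (by filter_upwards [hB.mem_nhds hz] with x hx using hgF x hx)
    have h2 := (hg' z hz).unique h1
    have h3 : l z • (G : E →ₗ[ℂ] E) - (L.smulRight (g z) : E →L[ℂ] E).toLinearMap =
        (l z ^ 2) • (fderiv ℂ F z : E →ₗ[ℂ] E) := by
      ext x
      simp [h2, hgF z hz, smul_smul]
      module
    rw [h3, LinearMap.det_smul, pow_add, hdet z hz, ContinuousLinearMap.det]
    ring
  ext v
  refine eq_zero_of_pow_eq_det_pencil (k := m + 2 * Module.finrank ℂ E) (by omega)
    (a := l p) (c := c) (A₀ := l p • (G : E →ₗ[ℂ] E) - (L.smulRight (g p) : E →L[ℂ] E).toLinearMap)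
    (A₁ := L v • (G : E →ₗ[ℂ] E) - (L.smulRight (G v) : E →L[ℂ] E).toLinearMap) ?_
  have hcont : Tendsto (fun s : ℂ => p + s • v) (𝓝 0) (𝓝 p) :=
    Continuous.tendsto' (by fun_prop) _ _ (by simp)
  filter_upwards [hcont (hB.mem_nhds hp)] with s hs
  have hs' : p + s • v ∈ B := hs
  have h1 := hmul _ hs'
  have h2 := hl _ hs'
  have h3 := hg _ hs'
  simp only [add_sub_cancel_left, map_smul, smul_eq_mul] at h2 h3
  rw [← h2, h1, h2, h3]
  congr 2
  ext x
  simp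
  module

theorem eq_isometry_of_inner_eq [FiniteDimensional ℂ E] {p : E} {r : ℝ} (hr : 0 < r)
    {F : E → E} {A : E →ₗ[ℂ] E} {α : ℂ} (hα : α ≠ 0)
    (hF : ∀ z ∈ Metric.ball p r, F z = F p + A (z - p))
    (h : ∀ z ∈ Metric.ball p r, ∀ w ∈ Metric.ball p r,
      1 + inner ℂ w z = α * (1 + inner ℂ (F w) (F z))) :
    (∀ u v, inner ℂ (A u) (A v) = inner ℂ u v) ∧ F p = A p := by
  have hp : p ∈ Metric.ball p r := Metric.mem_ball_self hr
  have hsmall : ∀ u : E, ∃ s : ℝ, s ≠ 0 ∧ p + (s : ℂ) • u ∈ Metric.ball p r := fun u => by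
    refine ⟨r / (2 * (‖u‖ + 1)), by positivity, ?_⟩
    have : 0 < ‖u‖ + 1 := by positivity
    rw [mem_ball_iff_norm, add_sub_cancel_left, norm_smul, norm_real, Real.norm_of_nonneg
      (by positivity), div_mul_eq_mul_div, div_lt_iff₀ (by positivity)]
    nlinarith [norm_nonneg u]
  have hA : ∀ u v, α * inner ℂ (A u) (A v) = inner ℂ u v := fun u v => by
    obtain ⟨s, hs0, hs⟩ := hsmall u
    obtain ⟨t, ht0, ht⟩ := hsmall v
    have h1 := h _ ht _ hs
    have h2 := h _ ht _ hp
    have h3 := h _ hp _ hs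
    have h4 := h _ hp _ hp
    rw [hF _ ht, hF _ hs] at h1
    rw [hF _ ht] at h2
    rw [hF _ hs] at h3
    simp only [add_sub_cancel_left, map_smul, inner_add_left, inner_add_right, inner_smul_left,
      inner_smul_right, conj_ofReal] at h1 h2 h3 h4
    have hs0' : (s : ℂ) ≠ 0 := ofReal_ne_zero.2 hs0
    have ht0' : (t : ℂ) ≠ 0 := ofReal_ne_zero.2 ht0
    -- The mixed second difference leaves only the sesquilinear term.
    have h5 : (s * t : ℂ) * (α * inner ℂ (A u) (A v)) = (s * t : ℂ) * inner ℂ u v := by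
      linear_combination -h1 + h2 + h3 - h4
    exact mul_left_cancel₀ (mul_ne_zero hs0' ht0') h5
  have hp' : ∀ v, α * inner ℂ (F p) (A v) = inner ℂ p v := fun v => by
    obtain ⟨t, ht0, ht⟩ := hsmall v
    have h2 := h _ ht _ hp
    have h4 := h _ hp _ hp
    rw [hF _ ht] at h2
    simp only [add_sub_cancel_left, map_smul, inner_add_right, inner_smul_right] at h2
    have h5 : (t : ℂ) * (α * inner ℂ (F p) (A v)) = t * inner ℂ p v := by
      linear_combination -h2 + h4
    exact mul_left_cancel₀ (ofReal_ne_zero.2 ht0) h5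
  have hinj : Function.Injective A := by
    refine (injective_iff_map_eq_zero A).2 fun u hu => ?_
    rw [← inner_self_eq_zero (𝕜 := ℂ), ← hA, hu, inner_zero_left, mul_zero]
  -- `F p - A p` is orthogonal to the range of `A`, which is the whole space.
  have hsurj := LinearMap.injective_iff_surjective.1 hinj
  have hFp : F p = A p := by
    obtain ⟨v, hv⟩ := hsurj (F p - A p)
    rw [← sub_eq_zero, ← inner_self_eq_zero (𝕜 := ℂ), ← mul_right_inj' hα, mul_zero]
    nth_rw 2 [← hv]
    rw [inner_sub_left, mul_sub, hp', hA, sub_self]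
  refine ⟨fun u v => ?_, hFp⟩
  have h4 := h _ hp _ hp
  -- At `(p, p)` the identity reads `1 + ⟪p, p⟫ = α + ⟪p, p⟫`.
  rw [hFp, mul_add, hA] at h4
  have : α = 1 := by linear_combination -h4
  simpa [this] using hA u v

end Rigidity

/-! ### From the Jacobian identity to a unitary matrix. -/

section Main

open Complex Set Filter Topology

variable {n : ℕ}

theorem differentiableAt_det_clm {E X : Type*} [NormedAddCommGroup E] [NormedSpace ℂ E]
    [FiniteDimensional ℂ E] [NormedAddCommGroup X] [NormedSpace ℂ X] {T : X → E →L[ℂ] E} {x : X}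
    (hT : DifferentiableAt ℂ T x) : DifferentiableAt ℂ (fun y => (T y).det) x := by
  let e := Module.finBasis ℂ E
  have h1 : (fun y => (T y).det) = fun y => (LinearMap.toMatrix e e (T y).toLinearMap).det := by
    ext y
    rw [LinearMap.det_toMatrix, ContinuousLinearMap.det]
  have h2 (i j) : DifferentiableAt ℂ (fun y => LinearMap.toMatrix e e (T y).toLinearMap i j) x := by
    simp only [LinearMap.toMatrix_apply]
    exact (LinearMap.toContinuousLinearMap (e.coord i)).differentiableAt.comp x
      (f := fun y => T y (e j)) (hT.clm_apply (differentiableAt_const _))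
  rw [h1]
  simp only [Matrix.det_apply]
  fun_prop

theorem inner_self_eq_ofReal (z : CSpace n) : inner ℂ z z = ((‖z‖ ^ 2 : ℝ) : ℂ) := by
  rw [inner_self_eq_norm_sq_to_K]; push_cast; rfl

/-- Taking the `m`-th root of the transformation rule: the Jacobian determinant of `F` is, up to a
constant, the `m`-th power of a holomorphic function `l` with
`1 + ⟪w, z⟫ = l z * conj (l w) * (1 + ⟪F w, F z⟫)`. -/
theorem exists_root_of_jacobian {m : ℕ} (hm : 1 ≤ m) {B : Set (CSpace n)} (hB : IsOpen B)
    (hc : Convex ℝ B) {p : CSpace n} (hp : p ∈ B) {C₁ C₂ : ℝ} (hC₁ : 0 < C₁) (hC₂ : 0 < C₂)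
    {F : CSpace n → CSpace n} {J : CSpace n → ℂ} (hF : ∀ z ∈ B, DifferentiableAt ℂ F z)
    (hJ : ∀ z ∈ B, DifferentiableAt ℂ J z)
    (h : ∀ z ∈ B, C₁ * (1 + ‖z‖ ^ 2) ^ m = C₂ * (1 + ‖F z‖ ^ 2) ^ m * ‖J z‖ ^ 2)
    (hne : ∀ z ∈ B, 1 + inner ℂ (F p) (F z) ≠ 0) :
    ∃ (l : CSpace n → ℂ) (c : ℂ), (∀ z ∈ B, DifferentiableAt ℂ l z) ∧
      (∀ z ∈ B, l z ≠ 0) ∧ (∀ z ∈ B, l z ^ m = c * J z) ∧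
      ∀ z ∈ B, ∀ w ∈ B, 1 + inner ℂ w z = l z * conj (l w) * (1 + inner ℂ (F w) (F z)) := by
  have hpol : ∀ z ∈ B, ∀ w ∈ B, (C₁ : ℂ) * (1 + inner ℂ w z) ^ m =
      C₂ * (1 + inner ℂ (F w) (F z)) ^ m * (J z * conj (J w)) := fun z hz w hw => by
    refine sub_eq_zero.1 (SesquiHolomorphicOn.eq_zero (Φ := fun z w : CSpace n =>
      (C₁ : ℂ) * (1 + inner ℂ w z) ^ m - C₂ * (1 + inner ℂ (F w) (F z)) ^ m * (J z * conj (J w)))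
      ?_ hB hc ?_ hz hw)
    · have hid := SesquiHolomorphicOn.inner (B := B) (f := fun z : CSpace n => z)
        (fun _ _ => differentiableAt_id)
      exact ((SesquiHolomorphicOn.const _).mul (((SesquiHolomorphicOn.const _).add hid).pow m)).sub
        (((SesquiHolomorphicOn.const _).mul (((SesquiHolomorphicOn.const _).add
          (SesquiHolomorphicOn.inner hF)).pow m)).mul
          ((SesquiHolomorphicOn.left hJ).mul (SesquiHolomorphicOn.right hJ)))
    · intro z hz
      rw [mul_conj, normSq_eq_norm_sq, inner_self_eq_ofReal, inner_self_eq_ofReal, sub_eq_zero]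
      exact_mod_cast h z hz
  -- Dividing by `√κ` normalizes `l` so that `‖c‖² = C₂ / C₁`, which makes the diagonal identity for
  -- `l` free of constants.
  set κ : ℝ := (1 + ‖p‖ ^ 2) / (1 + ‖F p‖ ^ 2) with hκ
  have hκ0 : 0 < κ := by positivity
  have hsκ : (√κ : ℂ) ≠ 0 := ofReal_ne_zero.2 (Real.sqrt_pos.2 hκ0).ne'
  have hC₁' : (C₁ : ℂ) ≠ 0 := ofReal_ne_zero.2 hC₁.ne'
  let l : CSpace n → ℂ := fun z => (1 + inner ℂ p z) / (1 + inner ℂ (F p) (F z)) / √κ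
  let c : ℂ := C₂ / C₁ * conj (J p) / (√κ : ℂ) ^ m
  have hld : ∀ z ∈ B, DifferentiableAt ℂ l z := fun z hz => by
    have h1 : DifferentiableAt ℂ (fun z : CSpace n => inner ℂ p z) z :=
      (innerSL ℂ p).differentiableAt
    have h2 : DifferentiableAt ℂ (fun z : CSpace n => inner ℂ (F p) (F z)) z :=
      (innerSL ℂ (F p)).differentiableAt.comp z (hF z hz)
    have h3 := (h1.const_add 1).mul (DifferentiableAt.fun_inv (h2.const_add 1) (hne z hz))
    exact h3.mul_const (√κ : ℂ)⁻¹
  have hlm : ∀ z ∈ B, l z ^ m = c * J z := fun z hz => by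
    have h1 := hpol z hz p hp
    have h3 := pow_ne_zero m (hne z hz)
    have h4 := pow_ne_zero m hsκ
    simp only [l, c, div_pow]
    field_simp
    linear_combination h1
  have hcn : ‖c‖ ^ 2 = C₂ / C₁ := by
    have h1 : κ ^ m * C₁ = C₂ * ‖J p‖ ^ 2 := by
      rw [hκ, div_pow, div_mul_eq_mul_div, div_eq_iff (by positivity), mul_comm, h p hp]; ring
    have h2 : (√κ ^ m) ^ 2 = κ ^ m := by
      rw [← pow_mul, mul_comm, pow_mul, Real.sq_sqrt hκ0.le]
    simp only [c, norm_div, norm_mul, norm_pow, norm_real, RCLike.norm_conj,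
      Real.norm_of_nonneg (Real.sqrt_nonneg κ), Real.norm_of_nonneg hC₁.le,
      Real.norm_of_nonneg hC₂.le]
    rw [div_pow, h2, mul_pow, div_pow]
    field_simp
    linear_combination -h1
  have hdiag : ∀ z ∈ B, 1 + ‖z‖ ^ 2 = ‖l z‖ ^ 2 * (1 + ‖F z‖ ^ 2) := fun z hz => by
    -- On the diagonal both sides are nonnegative reals, so the `m`-th root is unambiguous.
    refine (pow_left_inj₀ (by positivity) (by positivity) (by omega : m ≠ 0)).1 ?_
    have h1 : (‖l z‖ ^ 2) ^ m = C₂ / C₁ * ‖J z‖ ^ 2 := by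
      rw [← pow_mul, mul_comm, pow_mul, ← norm_pow, hlm z hz, norm_mul, mul_pow, hcn]
    rw [mul_pow, h1]
    have := h z hz
    field_simp
    linear_combination this
  refine ⟨l, c, hld, fun z hz h0 => ?_, hlm, fun z hz w hw => ?_⟩
  · have := hdiag z hz
    rw [h0, norm_zero] at this
    nlinarith [sq_nonneg ‖z‖]
  · refine sub_eq_zero.1 (SesquiHolomorphicOn.eq_zero (Φ := fun z w : CSpace n =>
      1 + inner ℂ w z - l z * conj (l w) * (1 + inner ℂ (F w) (F z))) ?_ hB hc ?_ hz hw)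
    · have hid := SesquiHolomorphicOn.inner (B := B) (f := fun z : CSpace n => z)
        (fun _ _ => differentiableAt_id)
      exact ((SesquiHolomorphicOn.const _).add hid).sub
        (((SesquiHolomorphicOn.left hld).mul (SesquiHolomorphicOn.right hld)).mul
          ((SesquiHolomorphicOn.const _).add (SesquiHolomorphicOn.inner hF)))
    · intro z hz
      rw [mul_conj, normSq_eq_norm_sq, inner_self_eq_ofReal, inner_self_eq_ofReal, sub_eq_zero]
      exact_mod_cast hdiag z hz

/-- Local form of the rigidity theorem. -/
theorem locally_linear_isometry {m : ℕ} (hm : 1 ≤ m) {U : Set (CSpace n)} (hU : IsOpen U)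
    {p : CSpace n} (hp : p ∈ U) {C₁ C₂ : ℝ} (hC₁ : 0 < C₁) (hC₂ : 0 < C₂)
    {F : CSpace n → CSpace n} (hF : HolomorphicOn F U)
    (h : ∀ z ∈ U, C₁ * (1 + ‖z‖ ^ 2) ^ m =
      C₂ * (1 + ‖F z‖ ^ 2) ^ m * ‖(fderiv ℂ F z).det‖ ^ 2) :
    ∃ A : CSpace n →ₗ[ℂ] CSpace n, (∀ u v, inner ℂ (A u) (A v) = inner ℂ u v) ∧
      ∀ᶠ z in 𝓝 p, F z = A z := by
  have hFd : ∀ z ∈ U, DifferentiableAt ℂ F z := fun z hz => (hF z hz).differentiableAt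
  have hJ : ∀ z ∈ U, DifferentiableAt ℂ (fun z => (fderiv ℂ F z).det) z := fun z hz =>
    differentiableAt_det_clm (hF z hz).fderiv.differentiableAt
  -- This is the denominator of `l`; it is at least `1` at `z = p`.
  have hne : ∀ᶠ z in 𝓝 p, 1 + inner ℂ (F p) (F z) ≠ 0 := by
    have hcont : ContinuousAt (fun z => 1 + inner ℂ (F p) (F z)) p :=
      continuousAt_const.add (continuousAt_const.inner (hFd p hp).continuousAt)
    refine hcont.eventually_ne ?_
    rw [inner_self_eq_ofReal]
    have : (1 + ‖F p‖ ^ 2 : ℝ) ≠ 0 := by positivity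
    exact_mod_cast this
  obtain ⟨r, hr, hball⟩ := Metric.eventually_nhds_iff_ball.1 (hne.and (hU.mem_nhds hp))
  have hpB : p ∈ Metric.ball p r := Metric.mem_ball_self hr
  obtain ⟨l, c, hld, hl0, hlm, hid⟩ := exists_root_of_jacobian hm Metric.isOpen_ball
    (convex_ball p r) hpB hC₁ hC₂ (fun z hz => hFd z (hball z hz).2)
    (fun z hz => hJ z (hball z hz).2) (fun z hz => h z (hball z hz).2)
    (fun z hz => (hball z hz).1)
  let g : CSpace n → CSpace n := fun z => l z • F z
  have haff : ∀ z ∈ Metric.ball p r, l z = l p + fderiv ℂ l p (z - p) ∧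
      g z = g p + fderiv ℂ g p (z - p) := fun z hz => by
    refine affine_of_inner_eq (convex_ball p r) hpB (hld p hpB)
      ((hld p hpB).fun_smul (hFd p hp)) (fun z hz w hw => ?_) hz
    simp only [hid z hz w hw, inner_smul_left, inner_smul_right]
    ring
  have hL : fderiv ℂ l p = 0 := linear_denominator_eq_zero Metric.isOpen_ball hpB
    (fun z hz => (haff z hz).1) (fun z hz => (haff z hz).2) (fun _ _ => rfl)
    (fun z hz => hFd z (hball z hz).2) hm hlm
  have hlp : ∀ z ∈ Metric.ball p r, l z = l p := fun z hz => by
    simpa [hL] using (haff z hz).1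
  let A : CSpace n →ₗ[ℂ] CSpace n := (l p)⁻¹ • (fderiv ℂ g p : CSpace n →ₗ[ℂ] CSpace n)
  have hFA : ∀ z ∈ Metric.ball p r, F z = F p + A (z - p) := fun z hz => by
    have h1 := (haff z hz).2
    simp only [g, hlp z hz] at h1
    rw [← inv_smul_smul₀ (hl0 p hpB) (F z), h1, smul_add, inv_smul_smul₀ (hl0 p hpB)]
    rfl
  obtain ⟨hA, hFp⟩ := eq_isometry_of_inner_eq hr (α := l p * conj (l p))
    (mul_ne_zero (hl0 p hpB) ((map_ne_zero _).2 (hl0 p hpB))) hFA (fun z hz w hw => by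
      rw [hid z hz w hw, hlp z hz, hlp w hw])
  refine ⟨A, hA, ?_⟩
  filter_upwards [Metric.ball_mem_nhds p hr] with z hz
  rw [hFA z hz, hFp, map_sub, add_sub_cancel]

theorem toEuclideanLin_symm_mem_unitaryGroup {A : CSpace n →ₗ[ℂ] CSpace n}
    (hA : ∀ u v, inner ℂ (A u) (A v) = inner ℂ u v) :
    Matrix.toEuclideanLin.symm A ∈ Matrix.unitaryGroup (Fin n) ℂ := by
  rw [Matrix.mem_unitaryGroup_iff', Matrix.star_eq_conjTranspose]
  apply Matrix.toEuclideanLin.injective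
  set M := Matrix.toEuclideanLin.symm A with hM
  have hMA : Matrix.toEuclideanLin M = A := by simp [hM]
  ext1 v
  refine ext_inner_left ℂ fun u => ?_
  have h1 : Matrix.toEuclideanLin (M.conjTranspose * M) v =
      Matrix.toEuclideanLin M.conjTranspose (Matrix.toEuclideanLin M v) := by
    simp [Matrix.toLpLin_apply, Matrix.mulVec_mulVec]
  rw [h1, Matrix.toEuclideanLin_conjTranspose_eq_adjoint, LinearMap.adjoint_inner_right, hMA, hA]
  simp

end Main

theorem mainTheorem6 (n m : ℕ) (hm : 1 ≤ m) (D₁ D₂ : Set (CSpace n))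
    (hD₁ : IsDomainIn D₁) (hD₂ : IsDomainIn D₂) (C₁ C₂ : ℝ) (hC₁ : 0 < C₁) (hC₂ : 0 < C₂)
    (hK₁ : ∀ z ∈ D₁, bergmanKernel D₁ z z = ((C₁ * (1 + ‖z‖ ^ 2) ^ m : ℝ) : ℂ))
    (hK₂ : ∀ z ∈ D₂, bergmanKernel D₂ z z = ((C₂ * (1 + ‖z‖ ^ 2) ^ m : ℝ) : ℂ))
    (U₁ U₂ : Set (CSpace n)) (hU₁ : IsDomainIn U₁) (hU₂ : IsDomainIn U₂)
    (hUD₁ : U₁ ⊆ D₁) (hUD₂ : U₂ ⊆ D₂)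
    (F : CSpace n → CSpace n) (hF : IsBiholomorphicMap F U₁ U₂)
    (hpres : ∀ z ∈ U₁, bergmanKernel D₁ z z =
      bergmanKernel D₂ (F z) (F z) * ((‖(fderiv ℂ F z).det‖ ^ 2 : ℝ) : ℂ)) :
    (∃ B ∈ Matrix.unitaryGroup (Fin n) ℂ, ∀ z ∈ U₁, F z = Matrix.toEuclideanLin B z) ∧
      C₁ = C₂ := by
  have hident : ∀ z ∈ U₁, C₁ * (1 + ‖z‖ ^ 2) ^ m =
      C₂ * (1 + ‖F z‖ ^ 2) ^ m * ‖(fderiv ℂ F z).det‖ ^ 2 := fun z hz => by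
    have h1 := hpres z hz
    rw [hK₁ z (hUD₁ hz), hK₂ _ (hUD₂ (hF.2.1 hz)), ← Complex.ofReal_mul] at h1
    exact Complex.ofReal_injective h1
  obtain ⟨p, hp⟩ := hU₁.2.nonempty
  obtain ⟨A, hA, hFA⟩ := locally_linear_isometry hm hU₁.1 hp hC₁ hC₂ hF.1 hident
  have hB := toEuclideanLin_symm_mem_unitaryGroup hA
  have hBA : Matrix.toEuclideanLin (Matrix.toEuclideanLin.symm A) = A := by simp
  refine ⟨⟨Matrix.toEuclideanLin.symm A, hB, fun z hz => ?_⟩, ?_⟩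
  · rw [hBA]
    exact hF.1.eqOn_of_preconnected_of_eventuallyEq
      (fun x _ => (LinearMap.toContinuousLinearMap A).analyticAt x) hU₁.2.isPreconnected hp hFA hz
  · have hnorm : ‖F p‖ = ‖p‖ := by
      rw [hFA.self_of_nhds]
      exact (A.isometryOfInner hA).norm_map p
    have hder : fderiv ℂ F p = LinearMap.toContinuousLinearMap A := by
      rw [Filter.EventuallyEq.fderiv_eq hFA]
      exact (LinearMap.toContinuousLinearMap A).fderiv
    -- With `‖F p‖ = ‖p‖`, a unimodular Jacobian reduces the rule at `p` to `C₁ = C₂`.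
    have hdet : ‖(fderiv ℂ F p).det‖ = 1 := by
      have h1 : (fderiv ℂ F p).det = (Matrix.toEuclideanLin.symm A).det := by
        rw [hder, ContinuousLinearMap.det, LinearMap.coe_toContinuousLinearMap]
        nth_rw 1 [← hBA]
        rw [Matrix.toEuclideanLin, Matrix.toLpLin_eq_toLin, LinearMap.det_toLin]
      rw [h1]
      exact CStarRing.norm_of_mem_unitary (Matrix.det_of_mem_unitary hB)
    have h1 := hident p hp
    rw [hnorm, hdet, one_pow, mul_one] at h1
    exact mul_right_cancel₀ (by positivity) h1
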